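/- Identify the subsets of $\mathbb Z^2$ with the elements of $\{0,1\}^{\mathbb Z^2}$, equipped with the product topology. Let $V=\{x\in\mathbb Z^2 : \gcd(x_1,x_2)=1\}$ be the set of visible points of $\mathbb Z^2$, let $\mathbb X_V=\overline{\{t+V : t\in\mathbb Z^2\}}\subset\{0,1\}^{\mathbb Z^2}$ be its hull, and let $\mathbb Z^2$ act on $\mathbb X_V$ by translations $X\mapsto t+X$. The topological dynamical system $(\mathbb X_V,\mathbb Z^2)$ has the following properties. (a) $(\mathbb X_V,\mathbb Z^2)$ is topologically ergodic, i.e. for any two nonempty open sets $U,W\subset\mathbb X_V$ the set $\{t\in\mathbb Z^2 : U\cap(t+W)\neq\varnothing\}$ is syndetic (finitely many of its translates cover $\mathbb Z^2$); in particular, it is topologically transitive. Its topological entropy (the supremum over all open covers $\mathcal U$ of $\limsup_{n\to\infty} n^{-2}\log N\big(\bigvee_{t\in\{0,\dots,n-1\}^2}(-t+\mathcal U)\big)$, where $N$ is the minimal cardinality of a subcover) is positive and equal to $\frac{6}{\pi^2}\log 2$. (b) $(\mathbb X_V,\mathbb Z^2)$ is proximal, i.e. for all $X,Y\in\mathbb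 X_V$ and every neighbourhood $U$ of the diagonal in $\mathbb X_V\times\mathbb X_V$ there is $t\in\mathbb Z^2$ with $(t+X,t+Y)\in U$. Moreover $\varnothing\in\mathbb X_V$, and $\{\varnothing\}$ is the unique $\mathbb Z^2$-minimal subset (minimal nonempty closed invariant subset) of $\mathbb X_V$. (c) $(\mathbb X_V,\mathbb Z^2)$ has no nontrivial topological Kronecker factor: every minimal equicontinuous $\mathbb Z^2$-system on a compact Hausdorff space that is the image of $\mathbb X_V$ under a continuous equivariant surjection is a single point. In particular, $(\mathbb X_V,\mathbb Z^2)$ has trivial topological point spectrum: if $f:\mathbb X_V\to\mathbb C$ is continuous, $f\not\equiv 0$, and $f(t+X)=\chi(t)f(X)$ for all $t\in\mathbb Z^2$, $X\in\mathbb X_V$, with a character $\chi$ of $\mathbb Z^2$, then $\chi=1$ and $f$ is constant; and $\chi=1$ does occur. (d) Let $G=\prod_p \mathbb Z^2/p\mathbb Z^2$ (product over all primes $p$, with the product topology), and let $x\in\mathbb Z^2$ act on $G$ by $g\mapsto g+\iota(x)$ with $\iota(x)=([x]_p)_p$. Then $K=(G,\mathbb Z^2)$ is a Kronecker system (minimal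 and equicontinuous, on a compact Hausdorff space), and $(\mathbb X_V,\mathbb Z^2)$ has a nontrivial topological joining with $K$: there is a closed $\mathbb Z^2$-invariant set $W\subsetneq\mathbb X_V\times G$ whose projections to $\mathbb X_V$ and to $G$ are both onto. Moreover, $(\mathbb X_V,\mathbb Z^2)$ fails to be topologically weakly mixing, i.e. the diagonal action of $\mathbb Z^2$ on $\mathbb X_V\times\mathbb X_V$ is not topologically transitive. -/

import Mathlib

open Set Filter Topology

universe u

noncomputable section

/-! ### Actions of a group on a topological space -/

namespace TopDyn

/-- A subset `S` of an additive group is syndetic if finitely many translates of `S` cover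
the group. -/
def IsSyndetic {G : Type*} [AddGroup G] (S : Set G) : Prop :=
  ∃ F : Finset G, ∀ g : G, ∃ f ∈ F, f + g ∈ S

/-- Topological ergodicity: for any two nonempty open sets `U` and `W`, the set of return times
`{g | U ∩ (g + W) ≠ ∅}` is syndetic. In particular it is nonempty, so that a topologically
ergodic action is topologically transitive. -/
def IsTopologicallyErgodic (G X : Type*) [AddGroup G] [TopologicalSpace X] [AddAction G X] :
    Prop :=
  ∀ U W : Set X, IsOpen U → U.Nonempty → IsOpen W → W.Nonempty →
    IsSyndetic {g : G | (U ∩ (fun x => g +ᵥ x) '' W).Nonempty}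

/-- Topological weak mixing: the diagonal action on `X × X` is topologically transitive. -/
def IsTopologicallyWeaklyMixing (G X : Type*) [AddGroup G] [TopologicalSpace X] [AddAction G X] :
    Prop :=
  AddAction.IsTopologicallyTransitive G (X × X)

/-- Proximality: every pair of points is moved into every neighbourhood of the diagonal by some
group element. (On a compact Hausdorff space the neighbourhoods of the diagonal are the
entourages of the unique compatible uniformity; for a compatible metric `d` this says that
`inf_g d (g + x) (g + y) = 0`.) -/
def IsProximal (G X : Type*) [AddGroup G] [TopologicalSpace X] [AddAction G X] : Prop :=
  ∀ x y : X, ∀ U ∈ 𝓝ˢ (diagonal X), ∃ g : G, (g +ᵥ x, g +ᵥ y) ∈ U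

/-- Equicontinuity of the action, with respect to the uniformity given by the neighbourhoods of
the diagonal (the unique compatible one if `X` is compact Hausdorff). -/
def IsEquicontinuous (G X : Type*) [AddGroup G] [TopologicalSpace X] [AddAction G X] : Prop :=
  ∀ U ∈ 𝓝ˢ (diagonal X), ∀ x : X, ∀ᶠ y in 𝓝 x, ∀ g : G, (g +ᵥ x, g +ᵥ y) ∈ U

/-- Topological Kronecker systems: minimal equicontinuous actions by homeomorphisms on compact
Hausdorff spaces. -/
structure IsKronecker (G X : Type*) [AddGroup G] [TopologicalSpace X] [AddAction G X] :
    Prop where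
  compact : CompactSpace X
  hausdorff : T2Space X
  continuous_vadd : ContinuousConstVAdd G X
  minimal : AddAction.IsMinimal G X
  equicontinuous : IsEquicontinuous G X

/-- A set which is invariant under the action. -/
def IsInvariant (G : Type*) {X : Type*} [AddGroup G] [AddAction G X] (M : Set X) : Prop :=
  ∀ g : G, ∀ x ∈ M, g +ᵥ x ∈ M

/-- Minimal subsets: the nonempty closed invariant sets without proper nonempty closed invariant
subsets. -/
structure IsMinimalSubset (G : Type*) {X : Type*} [AddGroup G] [TopologicalSpace X]
    [AddAction G X] (M : Set X) : Prop where
  nonempty : M.Nonempty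
  closed : IsClosed M
  invariant : IsInvariant G M
  minimal : ∀ M' ⊆ M, M'.Nonempty → IsClosed M' → IsInvariant G M' → M' = M

/-- Factor maps: equivariant continuous surjections. -/
structure IsFactorMap (G : Type*) {X Y : Type*} [AddGroup G] [TopologicalSpace X]
    [TopologicalSpace Y] [AddAction G X] [AddAction G Y] (π : X → Y) : Prop where
  continuous : Continuous π
  surjective : Function.Surjective π
  equivariant : ∀ (g : G) (x : X), π (g +ᵥ x) = g +ᵥ π x

/-- `f` is a continuous eigenfunction with eigenvalue (a character of `G`) `χ`. -/
structure IsEigenfunction {G X : Type*} [AddGroup G] [TopologicalSpace X] [AddAction G X]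
    (χ : AddChar G Circle) (f : X → ℂ) : Prop where
  continuous : Continuous f
  ne_zero : f ≠ 0
  map_vadd : ∀ (g : G) (x : X), f (g +ᵥ x) = (χ g : ℂ) * f x

/-- The topological point spectrum: the set of eigenvalues of continuous eigenfunctions. -/
def topologicalPointSpectrum (G X : Type*) [AddGroup G] [TopologicalSpace X] [AddAction G X] :
    Set (AddChar G Circle) :=
  {χ | ∃ f : X → ℂ, IsEigenfunction χ f}

/-- Topological joinings: closed invariant subsets of `X × Y` (with the diagonal action) which
project onto both `X` and `Y`. -/
structure IsJoining (G : Type*) {X Y : Type*} [AddGroup G] [TopologicalSpace X]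
    [TopologicalSpace Y] [AddAction G X] [AddAction G Y] (W : Set (X × Y)) : Prop where
  closed : IsClosed W
  invariant : IsInvariant G W
  fst_surj : Prod.fst '' W = univ
  snd_surj : Prod.snd '' W = univ

/-! ### Topological entropy of an action of `ℤ²` -/

/-- Open covers of `X`. -/
structure IsOpenCover {X : Type*} [TopologicalSpace X] (𝒰 : Set (Set X)) : Prop where
  isOpen : ∀ U ∈ 𝒰, IsOpen U
  covers : ⋃₀ 𝒰 = univ

/-- The smallest cardinality of a finite subcover of a cover (of a compact space). -/
def minSubcover {X : Type*} (𝒰 : Set (Set X)) : ℕ :=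
  sInf {n : ℕ | ∃ s : Finset (Set X), (s : Set (Set X)) ⊆ 𝒰 ∧ ⋃₀ (s : Set (Set X)) = univ ∧
    s.card = n}

/-- The common refinement `⋁_{t ∈ F} (-t + 𝒰)`. -/
def joinCover {G X : Type*} [AddGroup G] [AddAction G X] (F : Finset G) (𝒰 : Set (Set X)) :
    Set (Set X) :=
  {A | ∃ c : G → Set X, (∀ t ∈ F, c t ∈ 𝒰) ∧ A = ⋂ t ∈ F, (fun x => t +ᵥ x) ⁻¹' c t}

/-- The square `{0, …, n - 1}²` in `ℤ²`. -/
def box (n : ℕ) : Finset (ℤ × ℤ) := Finset.Ico (0 : ℤ) n ×ˢ Finset.Ico (0 : ℤ) n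

/-- The entropy of an action of `ℤ²` relative to an open cover. -/
def coverEntropy {X : Type*} [AddAction (ℤ × ℤ) X] (𝒰 : Set (Set X)) : EReal :=
  limsup (fun n : ℕ =>
    ((Real.log (minSubcover (joinCover (box n) 𝒰)) / (n : ℝ) ^ 2 : ℝ) : EReal)) atTop

/-- The topological entropy of an action of `ℤ²` on a compact space: the supremum, over all
open covers, of the entropy relative to the cover. -/
def topologicalEntropy (X : Type*) [TopologicalSpace X] [AddAction (ℤ × ℤ) X] : EReal :=
  ⨆ 𝒰 : {𝒰 : Set (Set X) // IsOpenCover 𝒰}, coverEntropy 𝒰.1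

end TopDyn

/-! ### The hull of the visible lattice points -/

namespace VisiblePoints

/-- Configurations, i.e. elements of `{0,1}^{ℤ²}`; the configuration `X` stands for the subset
`{x | X x = true}` of `ℤ²`. -/
def Config : Type := ℤ × ℤ → Bool

/-- The product topology of the discrete topology on `{0,1}`. -/
instance : TopologicalSpace Config := inferInstanceAs (TopologicalSpace (ℤ × ℤ → Bool))
instance : CompactSpace Config := inferInstanceAs (CompactSpace (ℤ × ℤ → Bool))
instance : T2Space Config := inferInstanceAs (T2Space (ℤ × ℤ → Bool))

/-- The translation action: `t +ᵥ X` stands for the subset `t + X`. -/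
instance : AddAction (ℤ × ℤ) Config where
  vadd t X := fun x => X (x - t)
  zero_vadd X := funext fun x => congrArg X (sub_zero x)
  add_vadd s t X := funext fun x => congrArg X (sub_add_eq_sub_sub x s t)

instance : ContinuousConstVAdd (ℤ × ℤ) Config where
  continuous_const_vadd t :=
    continuous_pi fun x => continuous_apply (A := fun _ : ℤ × ℤ => Bool) (x - t)

/-- The set `V` of visible points of `ℤ²`. -/
def visible : Config := fun x => decide (Int.gcd x.1 x.2 = 1)

/-- The empty subset of `ℤ²`. -/
def emptyConfig : Config := fun _ => false

/-- The hull of `V`: the closure of the set of all translates of `V`. -/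
def hull : Set Config := closure (AddAction.orbit (ℤ × ℤ) visible)

theorem vadd_mem_hull (t : ℤ × ℤ) {X : Config} (hX : X ∈ hull) : t +ᵥ X ∈ hull :=
  map_mem_closure (continuous_const_vadd t) hX fun Y hY => by
    obtain ⟨s, rfl⟩ := hY
    exact ⟨t + s, add_vadd t s visible⟩

/-- The hull as a space, with the subspace topology. -/
abbrev Hull : Type := hull

/-- The translation action on the hull. -/
instance : AddAction (ℤ × ℤ) Hull where
  vadd t X := ⟨t +ᵥ X.1, vadd_mem_hull t X.2⟩
  zero_vadd X := Subtype.ext (zero_vadd (ℤ × ℤ) X.1)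
  add_vadd s t X := Subtype.ext (add_vadd s t X.1)

instance : CompactSpace Hull := isCompact_iff_compactSpace.mp isClosed_closure.isCompact

instance : ContinuousConstVAdd (ℤ × ℤ) Hull where
  continuous_const_vadd t :=
    ((continuous_const_vadd t).comp continuous_subtype_val).subtype_mk _

/-! ### The rotation on `∏_p (ℤ/p)²` -/

/-- The compact group `∏_p (ℤ² / pℤ²)`, with `p` ranging over all primes. -/
def KGroup : Type := ∀ p : Nat.Primes, ZMod (p : ℕ) × ZMod (p : ℕ)

instance : AddCommGroup KGroup :=
  inferInstanceAs (AddCommGroup (∀ p : Nat.Primes, ZMod (p : ℕ) × ZMod (p : ℕ)))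

/-- The product topology of the discrete topologies. -/
instance : TopologicalSpace KGroup :=
  inferInstanceAs (TopologicalSpace (∀ p : Nat.Primes, ZMod (p : ℕ) × ZMod (p : ℕ)))

/-- The diagonal homomorphism `x ↦ ([x]_p)_p`. -/
def iota : ℤ × ℤ →+ KGroup where
  toFun x := fun p => ((x.1 : ZMod (p : ℕ)), (x.2 : ZMod (p : ℕ)))
  map_zero' := funext fun _ => Prod.ext Int.cast_zero Int.cast_zero
  map_add' x y := funext fun _ => Prod.ext (Int.cast_add x.1 y.1) (Int.cast_add x.2 y.2)

/-- `ℤ²` acts on the compact group by `g ↦ g + iota x`. -/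
instance : AddAction (ℤ × ℤ) KGroup where
  vadd x g := g + iota x
  zero_vadd g := (congrArg (g + ·) (map_zero iota)).trans (add_zero g)
  add_vadd x y g := by
    change g + iota (x + y) = g + iota y + iota x
    rw [map_add]
    abel

end VisiblePoints

end

/-! A configuration belongs to the hull exactly when it is admissible, i.e. misses some coset of
`pℤ²` for every prime `p` (`mem_hull_iff`). The nontrivial half, `exists_visible_translate`, places
any finite admissible pattern in `V` by the Chinese remainder theorem. Everything else works with
admissible sets.

Remainders modulo distinct primes can be prescribed independently, so a translation can push the
missed cosets over any finite window: every orbit closure contains `∅`, even for two configurations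
simultaneously. This fixed point gives proximality, the unique minimal set, and the triviality of
Kronecker factors and eigenfunctions. Ergodicity follows by superposing two finite patterns: only
small primes can obstruct, and they merely restrict the translation vector to a coset of some `Mℤ²`.

For the entropy, patterns in a window are counted. An admissible pattern avoids one coset for each
`p < L`, which leaves the proportion `∏_{p<L} (1 - p⁻²)` of the points; this bounds the number of
patterns from above. Conversely, every subset of such a set is admissible when the window has fewer
than `L²` points. The product tends to `1/ζ(2) = 6/π²`.

The missed cosets also link the hull to `∏_p (ℤ/p)²`: pairs `(X, g)` with `X` missing the cosets `g`
form the joining. Configurations meeting three cosets of `2ℤ²` remember the fourth, which rules out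
weak mixing. -/

noncomputable section

namespace VisiblePoints

/-! ### Admissible sets -/

/-- The residue class of a lattice point modulo `p`. -/
def residue (p : ℕ) : ℤ × ℤ →+ ZMod p × ZMod p :=
  (Int.castAddHom (ZMod p)).prodMap (Int.castAddHom (ZMod p))

theorem residue_apply (p : ℕ) (x : ℤ × ℤ) : residue p x = ((x.1 : ZMod p), (x.2 : ZMod p)) := rfl

/-- A set of lattice points is admissible if, for every prime `p`, it misses at least one coset of
`pℤ²`. -/
def IsAdmissible (P : Set (ℤ × ℤ)) : Prop :=
  ∀ p : ℕ, p.Prime → ∃ g : ZMod p × ZMod p, ∀ x ∈ P, residue p x ≠ g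

theorem IsAdmissible.mono {P Q : Set (ℤ × ℤ)} (hQ : IsAdmissible Q) (h : P ⊆ Q) :
    IsAdmissible P := fun p hp => by
  obtain ⟨g, hg⟩ := hQ p hp
  exact ⟨g, fun x hx => hg x (h hx)⟩

/-- The points of a configuration. -/
def support (X : Config) : Set (ℤ × ℤ) := {x | X x = true}

@[simp] theorem mem_support {X : Config} {x : ℤ × ℤ} : x ∈ support X ↔ X x = true := Iff.rfl

theorem vadd_apply (t : ℤ × ℤ) (X : Config) (x : ℤ × ℤ) : (t +ᵥ X) x = X (x - t) := rfl

theorem residue_eq_iff {p : ℕ} {x y : ℤ × ℤ} :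
    residue p x = residue p y ↔ (p : ℤ) ∣ x.1 - y.1 ∧ (p : ℤ) ∣ x.2 - y.2 := by
  simp only [residue_apply, Prod.mk.injEq, ← sub_eq_zero (b := ((_ : ℤ) : ZMod p)),
    ← Int.cast_sub, ZMod.intCast_zmod_eq_zero_iff_dvd]

theorem residue_eq_zero_iff {p : ℕ} {x : ℤ × ℤ} :
    residue p x = 0 ↔ (p : ℤ) ∣ x.1 ∧ (p : ℤ) ∣ x.2 := by
  simpa using residue_eq_iff (p := p) (x := x) (y := 0)

theorem visible_iff {x : ℤ × ℤ} :
    visible x = true ↔ ∀ p : ℕ, p.Prime → residue p x ≠ 0 := by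
  rw [visible, decide_eq_true_iff]
  constructor
  · intro h p hp h0
    rw [residue_eq_zero_iff] at h0
    have := Int.dvd_coe_gcd h0.1 h0.2
    rw [h] at this
    exact hp.one_lt.ne' (by exact_mod_cast Int.natAbs_dvd_natAbs.mpr this |> Nat.dvd_one.mp)
  · intro h
    by_contra hne
    obtain ⟨p, hp, hd⟩ := Nat.exists_prime_and_dvd hne
    have hd' : (p : ℤ) ∣ (Int.gcd x.1 x.2 : ℤ) := by exact_mod_cast hd
    exact h p hp (residue_eq_zero_iff.mpr
      ⟨hd'.trans (Int.gcd_dvd_left ..), hd'.trans (Int.gcd_dvd_right ..)⟩)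

theorem isAdmissible_visible : IsAdmissible (support visible) := fun p hp =>
  ⟨0, fun _ hx => visible_iff.mp hx p hp⟩

theorem IsAdmissible.vadd {X : Config} (h : IsAdmissible (support X)) (t : ℤ × ℤ) :
    IsAdmissible (support (t +ᵥ X)) := fun p hp => by
  obtain ⟨g, hg⟩ := h p hp
  refine ⟨g + residue p t, fun x hx h' => hg (x - t) hx ?_⟩
  rw [map_sub, h', add_sub_cancel_right]

/-- A finite set misses a residue modulo every `p` exceeding its cardinality. -/
theorem exists_zmod_notMem_image {α : Type*} (s : Finset α) (p : ℕ) [NeZero p] (h : s.card < p)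
    (f : α → ZMod p) : ∃ c : ZMod p, ∀ a ∈ s, f a ≠ c := by
  have hlt : (s.image f).card < (Finset.univ : Finset (ZMod p)).card := by
    rw [Finset.card_univ, ZMod.card]
    exact Finset.card_image_le.trans_lt h
  obtain ⟨c, -, hc⟩ := Finset.exists_mem_notMem_of_card_lt_card hlt
  exact ⟨c, fun a ha h' => hc (Finset.mem_image.mpr ⟨a, ha, h'⟩)⟩

/-- A finite set misses a coset of `pℤ²` whenever `p²` exceeds its cardinality. -/
theorem exists_residue_notMem_image (s : Finset (ℤ × ℤ)) (p : ℕ) [NeZero p] (h : s.card < p ^ 2) :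
    ∃ g : ZMod p × ZMod p, ∀ x ∈ s, residue p x ≠ g := by
  have hlt : (s.image (residue p)).card < (Finset.univ : Finset (ZMod p × ZMod p)).card := by
    rw [Finset.card_univ, Fintype.card_prod, ZMod.card, ← sq]
    exact Finset.card_image_le.trans_lt h
  obtain ⟨c, -, hc⟩ := Finset.exists_mem_notMem_of_card_lt_card hlt
  exact ⟨c, fun a ha h' => hc (Finset.mem_image.mpr ⟨a, ha, h'⟩)⟩

/-! ### Chinese remaindering -/

/-- Chinese remainder theorem for a finite set of primes. -/
theorem exists_int_residues (S : Finset ℕ) (hS : ∀ p ∈ S, p.Prime) (r : ∀ p : ℕ, ZMod p) :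
    ∃ t : ℤ, ∀ p ∈ S, (t : ZMod p) = r p := by
  obtain ⟨k, hk⟩ := Nat.chineseRemainderOfFinset (fun p => (r p).val) id S
    (fun p hp => (hS p hp).ne_zero)
    (fun p hp q hq hpq => (Nat.coprime_primes (hS p hp) (hS q hq)).mpr hpq)
  refine ⟨k, fun p hp => ?_⟩
  have := (hS p hp).pos
  have : NeZero p := ⟨this.ne'⟩
  have h := (ZMod.natCast_eq_natCast_iff _ _ p).mpr (hk p hp)
  rw [Int.cast_natCast, h, ZMod.natCast_zmod_val]

/-- Chinese remainder theorem in `ℤ²`. -/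
theorem exists_residues (S : Finset ℕ) (hS : ∀ p ∈ S, p.Prime) (r : ∀ p : ℕ, ZMod p × ZMod p) :
    ∃ t : ℤ × ℤ, ∀ p ∈ S, residue p t = r p := by
  obtain ⟨a, ha⟩ := exists_int_residues S hS fun p => (r p).1
  obtain ⟨b, hb⟩ := exists_int_residues S hS fun p => (r p).2
  exact ⟨(a, b), fun p hp => Prod.ext (ha p hp) (hb p hp)⟩

/-- The Chinese remainder theorem with a solution outside a given finite set. -/
theorem exists_int_residues_notMem (S : Finset ℕ) (hS : ∀ p ∈ S, p.Prime)
    (r : ∀ p : ℕ, ZMod p) (A : Finset ℤ) :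
    ∃ t : ℤ, t ∉ A ∧ ∀ p ∈ S, (t : ZMod p) = r p := by
  obtain ⟨t, ht⟩ := exists_int_residues S hS r
  have hM : (((∏ p ∈ S, p : ℕ) : ℤ)) ≠ 0 := by
    exact_mod_cast Finset.prod_ne_zero_iff.mpr fun p hp => (hS p hp).ne_zero
  have hinj : Function.Injective fun k : ℤ => t + ((∏ p ∈ S, p : ℕ) : ℤ) * k := fun a b h =>
    mul_left_cancel₀ hM (add_left_cancel h)
  obtain ⟨_, ⟨k, rfl⟩, hk⟩ := (infinite_range_of_injective hinj).exists_notMem_finset A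
  refine ⟨_, hk, fun p hp => ?_⟩
  have : ((∏ p ∈ S, p : ℕ) : ZMod p) = 0 :=
    (ZMod.natCast_eq_zero_iff _ _).mpr (Finset.dvd_prod_of_mem _ hp)
  rw [Int.cast_add, Int.cast_mul, Int.cast_natCast, this, zero_mul, add_zero, ht p hp]

/-- There are arbitrarily large distinct primes indexed by a countable type. -/
theorem exists_injective_primes (α : Type*) [Countable α] (N : ℕ) :
    ∃ q : α → ℕ, Function.Injective q ∧ ∀ a, (q a).Prime ∧ N ≤ q a := by
  obtain ⟨e, he⟩ := exists_injective_nat α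
  have hinf : {p : ℕ | p.Prime ∧ N ≤ p}.Infinite := by
    rw [Set.infinite_iff_exists_gt]
    intro n
    obtain ⟨p, hp, hpp⟩ := Nat.exists_infinite_primes (max N (n + 1))
    exact ⟨p, ⟨hpp, (le_max_left ..).trans hp⟩, (le_max_right N (n + 1)).trans hp⟩
  exact ⟨fun a => hinf.natEmbedding _ (e a),
    fun a b h => he ((hinf.natEmbedding _).injective (Subtype.ext h)),
    fun a => (hinf.natEmbedding _ (e a)).2⟩

/-! ### The hull consists of the admissible configurations -/

/-- Every finite admissible pattern occurs in `V`. -/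
theorem exists_visible_translate {B P : Finset (ℤ × ℤ)} (hPB : P ⊆ B)
    (hP : IsAdmissible (P : Set (ℤ × ℤ))) :
    ∃ t : ℤ × ℤ, ∀ b ∈ B, visible (b - t) = true ↔ b ∈ P := by
  classical
  choose! g hg using hP
  -- a bound exceeding the number of points and all differences of coordinates
  obtain ⟨N, hNP, hNB⟩ : ∃ N : ℕ, P.card < N ∧
      ∀ b ∈ B, ∀ b' ∈ B, ∀ p : ℕ, N ≤ p → residue p b = residue p b' → b = b' := by
    refine ⟨P.card + 1 + ∑ b ∈ B, 2 * (b.1.natAbs + b.2.natAbs), by omega, ?_⟩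
    intro b hb b' hb' p hp h
    have h1 := Finset.single_le_sum (f := fun b : ℤ × ℤ => 2 * (b.1.natAbs + b.2.natAbs))
      (fun _ _ => Nat.zero_le _) hb
    have h2 := Finset.single_le_sum (f := fun b : ℤ × ℤ => 2 * (b.1.natAbs + b.2.natAbs))
      (fun _ _ => Nat.zero_le _) hb'
    obtain ⟨h3, h4⟩ := residue_eq_iff.mp h
    have h5 := Int.eq_zero_of_abs_lt_dvd h3 (by rw [Int.abs_eq_natAbs]; omega)
    have h6 := Int.eq_zero_of_abs_lt_dvd h4 (by rw [Int.abs_eq_natAbs]; omega)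
    exact Prod.ext (by omega) (by omega)
  -- Each unwanted point `b ∈ B \ P` gets its own prime `q b ≥ N`, and `t ≡ b` modulo it makes `b -
  -- t` invisible. Points of `B` are distinct modulo `q b`, so no point of `P` is affected.
  obtain ⟨q, hq, hqp⟩ := exists_injective_primes (ℤ × ℤ) N
  -- the residues prescribed for `t`
  let r : ∀ p : ℕ, ZMod p × ZMod p := fun p =>
    if p < N then g p else residue p (Function.invFun q p)
  let S : Finset ℕ := Nat.primesBelow N ∪ (B \ P).image q
  have hS : ∀ p ∈ S, p.Prime := by
    intro p hp
    rcases Finset.mem_union.mp hp with h | h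
    · exact Nat.prime_of_mem_primesBelow h
    · obtain ⟨b, -, rfl⟩ := Finset.mem_image.mp h
      exact (hqp b).1
  have hr : ∀ b ∈ B \ P, r (q b) = residue (q b) b := by
    intro b _
    simp only [r, if_neg (hqp b).2.not_gt, Function.leftInverse_invFun hq b]
  have hrP : ∀ p ∈ S, ∀ b ∈ P, residue p b ≠ r p := by
    intro p hp b hb h
    by_cases hpN : p < N
    · simp only [r, if_pos hpN] at h
      exact hg p (hS p hp) b hb h
    · rcases Finset.mem_union.mp hp with h' | h'
      · exact hpN (Nat.lt_of_mem_primesBelow h')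
      · obtain ⟨b', hb', rfl⟩ := Finset.mem_image.mp h'
        rw [hr b' hb'] at h
        obtain ⟨hb'B, hb'P⟩ := Finset.mem_sdiff.mp hb'
        exact hb'P (hNB b (hPB hb) b' hb'B _ (hqp b').2 h ▸ hb)
  -- The first coordinate is fixed first. Since `b.1 ≠ t₁` on `P`, only finitely many primes outside
  -- `S` divide some `b.1 - t₁`. Each of them exceeds `P.card`, so `t₂` can avoid all residues of
  -- second coordinates of `P`.
  obtain ⟨t₁, ht₁, ht₁r⟩ := exists_int_residues_notMem S hS (fun p => (r p).1) (P.image Prod.fst)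
  let S' : Finset ℕ := S ∪ (∏ b ∈ P, (b.1 - t₁)).natAbs.primeFactors
  have hS' : ∀ p ∈ S', p.Prime := fun p hp => (Finset.mem_union.mp hp).elim (hS p)
    fun h => Nat.prime_of_mem_primeFactors h
  have hc : ∀ p : ℕ, p.Prime → p ∉ S → ∃ c : ZMod p, ∀ b ∈ P, ((b.2 : ℤ) : ZMod p) ≠ c := by
    intro p hp hpS
    have : NeZero p := ⟨hp.ne_zero⟩
    refine exists_zmod_notMem_image P p (hNP.trans_le ?_) _
    by_contra hlt
    exact hpS (Finset.mem_union_left _ (Nat.mem_primesBelow.mpr ⟨not_le.mp hlt, hp⟩))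
  choose! c hc using hc
  obtain ⟨t₂, ht₂⟩ := exists_int_residues S' hS' (fun p => if p ∈ S then (r p).2 else c p)
  have ht : ∀ p ∈ S, residue p (t₁, t₂) = r p := fun p hp => by
    have := ht₂ p (Finset.mem_union_left _ hp)
    rw [if_pos hp] at this
    exact Prod.ext (ht₁r p hp) this
  refine ⟨(t₁, t₂), fun b hb => ⟨fun hv => ?_, fun hbP => visible_iff.mpr fun p hp h0 => ?_⟩⟩
  · by_contra hbP
    have hmem : b ∈ B \ P := Finset.mem_sdiff.mpr ⟨hb, hbP⟩
    refine visible_iff.mp hv (q b) (hqp b).1 ?_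
    rw [map_sub, ht _ (Finset.mem_union_right _ (Finset.mem_image_of_mem _ hmem)), hr b hmem,
      sub_self]
  · rw [map_sub, sub_eq_zero] at h0
    by_cases hpS : p ∈ S
    · exact hrP p hpS b hbP (h0.trans (ht p hpS))
    · have hd := (residue_eq_iff.mp h0).1
      have hne : (∏ b ∈ P, (b.1 - t₁)) ≠ 0 := Finset.prod_ne_zero_iff.mpr fun b hb h =>
        ht₁ (Finset.mem_image.mpr ⟨b, hb, sub_eq_zero.mp h⟩)
      have hpS' : p ∈ S' := by
        refine Finset.mem_union_right _ (Nat.mem_primeFactors.mpr ⟨hp, ?_, by simpa using hne⟩)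
        exact Int.natCast_dvd.mp (hd.trans (Finset.dvd_prod_of_mem (fun b : ℤ × ℤ => b.1 - t₁) hbP))
      have h2 := ht₂ p hpS'
      rw [if_neg hpS] at h2
      exact hc p hp hpS b hbP ((congrArg Prod.snd h0).trans h2)

/-- Neighbourhoods in the space of configurations contain cylinder sets. -/
theorem exists_window_of_mem_nhds {X : Config} {U : Set Config} (hU : U ∈ 𝓝 X) :
    ∃ B : Finset (ℤ × ℤ), ∀ Y : Config, (∀ x ∈ B, Y x = X x) → Y ∈ U := by
  obtain ⟨V, hVU, hV, hX⟩ := mem_nhds_iff.mp hU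
  obtain ⟨B, u, hu, hB⟩ := isOpen_pi_iff.mp (show IsOpen (X := ℤ × ℤ → Bool) V from hV) X hX
  refine ⟨B, fun Y hY => hVU (hB ?_)⟩
  intro x hx
  rw [show Y x = X x from hY x hx]
  exact (hu x hx).2

theorem continuous_eval (x : ℤ × ℤ) : Continuous fun X : Config => X x :=
  continuous_apply (A := fun _ : ℤ × ℤ => Bool) x

/-- Each prime has only finitely many cosets, so the existential quantifier over `g` becomes a
finite union of closed sets. -/
theorem isClosed_isAdmissible : IsClosed {X : Config | IsAdmissible (support X)} := by
  have : {X : Config | IsAdmissible (support X)} = ⋂ (p : ℕ) (_ : p.Prime),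
      ⋃ g : ZMod p × ZMod p, ⋂ (x : ℤ × ℤ) (_ : residue p x = g), {X : Config | X x = false} := by
    ext X
    simp only [mem_ofPred_eq, IsAdmissible, mem_iInter, mem_iUnion, mem_support]
    refine forall₂_congr fun p hp => exists_congr fun g => forall_congr' fun x => ?_
    rw [imp_not_comm, Bool.not_eq_true]
  rw [this]
  refine isClosed_iInter fun p => isClosed_iInter fun hp => ?_
  have : NeZero p := ⟨hp.ne_zero⟩
  refine isClosed_iUnion_of_finite fun g => isClosed_iInter fun x => isClosed_iInter fun _ => ?_
  exact isClosed_eq (continuous_eval x) continuous_const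

theorem mem_hull_iff {X : Config} : X ∈ hull ↔ IsAdmissible (support X) := by
  constructor
  · refine fun h => closure_minimal ?_ isClosed_isAdmissible h
    rintro _ ⟨t, rfl⟩
    exact isAdmissible_visible.vadd t
  · classical
    intro h
    refine mem_closure_iff_nhds.mpr fun U hU => ?_
    obtain ⟨B, hB⟩ := exists_window_of_mem_nhds hU
    obtain ⟨t, ht⟩ := exists_visible_translate (B.filter_subset fun x => X x = true)
      (h.mono fun x hx => (Finset.mem_filter.mp hx).2)
    refine ⟨t +ᵥ visible, hB _ fun x hx => ?_, ⟨t, rfl⟩⟩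
    rw [vadd_apply, Bool.eq_iff_iff, ht x hx, Finset.mem_filter]
    exact and_iff_right hx

theorem isAdmissible_hull (X : Hull) : IsAdmissible (support X.1) := mem_hull_iff.mp X.2

/-- Neighbourhoods in the hull contain cylinder sets. -/
theorem exists_window_of_mem_nhds_hull {X : Hull} {U : Set Hull} (hU : U ∈ 𝓝 X) :
    ∃ B : Finset (ℤ × ℤ), ∀ Y : Hull, (∀ x ∈ B, Y.1 x = X.1 x) → Y ∈ U := by
  obtain ⟨V, hV, hVU⟩ := mem_nhds_subtype _ _ _ |>.mp hU
  obtain ⟨B, hB⟩ := exists_window_of_mem_nhds hV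
  exact ⟨B, fun Y hY => hVU (hB Y.1 hY)⟩

theorem hull_vadd_apply (t : ℤ × ℤ) (X : Hull) (x : ℤ × ℤ) : (t +ᵥ X).1 x = X.1 (x - t) := rfl

/-! ### The empty configuration, proximality and minimal sets -/

theorem emptyConfig_mem_hull : emptyConfig ∈ hull :=
  mem_hull_iff.mpr fun _ _ => ⟨0, fun _ hx => absurd hx Bool.false_ne_true⟩

/-- The empty configuration as a point of the hull. -/
def emptyHull : Hull := ⟨emptyConfig, emptyConfig_mem_hull⟩

theorem vadd_emptyHull (t : ℤ × ℤ) : t +ᵥ emptyHull = emptyHull := rfl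

/-- Any two elements of the hull have a common translate without points in a given finite
window. -/
theorem exists_vadd_eq_empty (X Y : Hull) (B : Finset (ℤ × ℤ)) :
    ∃ t : ℤ × ℤ, ∀ x ∈ B, (t +ᵥ X).1 x = false ∧ (t +ᵥ Y).1 x = false := by
  classical
  have hX := isAdmissible_hull X
  have hY := isAdmissible_hull Y
  choose! g hg using hX
  choose! h hh using hY
  -- A separate prime for each point of the window and each of the two configurations; modulo that
  -- prime, `t` is chosen so that `x - t` falls in the missed coset.
  obtain ⟨q, hq, hqp⟩ := exists_injective_primes ((ℤ × ℤ) ⊕ (ℤ × ℤ)) 0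
  obtain ⟨t, ht⟩ := exists_residues ((B.image fun x => q (.inl x)) ∪ B.image fun x => q (.inr x))
    (by simp only [Finset.mem_union, Finset.mem_image]
        rintro _ (⟨x, -, rfl⟩ | ⟨x, -, rfl⟩) <;> exact (hqp _).1)
    (fun p => (Function.invFun q p).elim (fun x => residue p x - g p)
      fun x => residue p x - h p)
  refine ⟨t, fun x hx => ⟨?_, ?_⟩⟩
  · have := ht (q (.inl x)) (Finset.mem_union_left _ (Finset.mem_image_of_mem _ hx))
    rw [Function.leftInverse_invFun hq (.inl x), Sum.elim_inl] at this
    rw [hull_vadd_apply, ← Bool.not_eq_true]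
    exact fun hmem => hg _ (hqp _).1 _ hmem (by rw [map_sub, this, sub_sub_cancel])
  · have := ht (q (.inr x)) (Finset.mem_union_right _ (Finset.mem_image_of_mem _ hx))
    rw [Function.leftInverse_invFun hq (.inr x), Sum.elim_inr] at this
    rw [hull_vadd_apply, ← Bool.not_eq_true]
    exact fun hmem => hh _ (hqp _).1 _ hmem (by rw [map_sub, this, sub_sub_cancel])

/-- The empty configuration is in the orbit closure of every element of the hull. -/
theorem exists_vadd_mem_nhds_empty (X : Hull) {U : Set Hull} (hU : U ∈ 𝓝 emptyHull) :
    ∃ t : ℤ × ℤ, t +ᵥ X ∈ U := by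
  obtain ⟨B, hB⟩ := exists_window_of_mem_nhds_hull hU
  obtain ⟨t, ht⟩ := exists_vadd_eq_empty X X B
  exact ⟨t, hB _ fun x hx => (ht x hx).1⟩

theorem isProximal_hull : TopDyn.IsProximal (ℤ × ℤ) Hull := fun X Y U hU => by
  have hE : U ∈ 𝓝 (emptyHull, emptyHull) := nhds_le_nhdsSet (mem_diagonal emptyHull) hU
  obtain ⟨V, hV, W, hW, hVW⟩ := mem_nhds_prod_iff.mp hE
  classical
  obtain ⟨B, hB⟩ := exists_window_of_mem_nhds_hull hV
  obtain ⟨C, hC⟩ := exists_window_of_mem_nhds_hull hW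
  obtain ⟨t, ht⟩ := exists_vadd_eq_empty X Y (B ∪ C)
  exact ⟨t, hVW ⟨hB _ fun x hx => (ht x (Finset.mem_union_left _ hx)).1,
    hC _ fun x hx => (ht x (Finset.mem_union_right _ hx)).2⟩⟩

theorem emptyHull_mem_of_isInvariant {M : Set Hull} (hne : M.Nonempty) (hc : IsClosed M)
    (hi : TopDyn.IsInvariant (ℤ × ℤ) M) : emptyHull ∈ M := by
  obtain ⟨X, hX⟩ := hne
  refine hc.closure_subset (mem_closure_iff_nhds.mpr fun U hU => ?_)
  obtain ⟨t, ht⟩ := exists_vadd_mem_nhds_empty X hU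
  exact ⟨_, ht, hi t X hX⟩

theorem isMinimalSubset_iff {M : Set Hull} :
    TopDyn.IsMinimalSubset (ℤ × ℤ) M ↔ M = {emptyHull} := by
  have hinv : TopDyn.IsInvariant (ℤ × ℤ) {emptyHull} := by
    rintro t _ rfl
    exact vadd_emptyHull t
  constructor
  · intro h
    exact (h.minimal _ (singleton_subset_iff.mpr
      (emptyHull_mem_of_isInvariant h.nonempty h.closed h.invariant))
      (singleton_nonempty _) isClosed_singleton hinv).symm
  · rintro rfl
    exact ⟨singleton_nonempty _, isClosed_singleton, hinv,
      fun M' hM' hne _ _ => hne.subset_singleton_iff.mp hM'⟩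

/-! ### Kronecker factors and eigenfunctions -/

/-- The image of `∅` is a fixed point; by minimality its one-point orbit is dense, and it is closed.
-/
theorem subsingleton_of_isFactorMap {Y : Type*} [TopologicalSpace Y] [AddAction (ℤ × ℤ) Y]
    (hY : TopDyn.IsKronecker (ℤ × ℤ) Y) (π : Hull → Y) (hπ : TopDyn.IsFactorMap (ℤ × ℤ) π) :
    Subsingleton Y := by
  have := hY.hausdorff
  have horbit : AddAction.orbit (ℤ × ℤ) (π emptyHull) = {π emptyHull} := by
    refine eq_singleton_iff_unique_mem.mpr ⟨AddAction.mem_orbit_self _, ?_⟩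
    rintro _ ⟨t, rfl⟩
    exact (hπ.equivariant t emptyHull).symm
  have hd := hY.minimal.dense_orbit (π emptyHull)
  rw [horbit] at hd
  have huniv : ({π emptyHull} : Set Y) = univ := by
    rw [← hd.closure_eq, isClosed_singleton.closure_eq]
  exact subsingleton_of_univ_subsingleton (huniv ▸ subsingleton_singleton)

/-- `‖f‖` is continuous and invariant, and `∅` lies in every orbit closure. -/
theorem norm_eigenfunction {χ : AddChar (ℤ × ℤ) Circle} {f : Hull → ℂ}
    (hf : TopDyn.IsEigenfunction χ f) (X : Hull) : ‖f X‖ = ‖f emptyHull‖ := by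
  by_contra hne
  have hU : {Y : Hull | ‖f Y‖ ≠ ‖f X‖} ∈ 𝓝 emptyHull :=
    (isOpen_ne_fun hf.continuous.norm continuous_const).mem_nhds (Ne.symm hne)
  obtain ⟨t, ht⟩ := exists_vadd_mem_nhds_empty X hU
  exact ht (by rw [hf.map_vadd, norm_mul, Circle.norm_coe, one_mul])

/-- The eigenvalue equation is read off at the fixed point `∅`, where `f` cannot vanish because
`‖f‖` is constant. -/
theorem eigenvalue_eq_one {χ : AddChar (ℤ × ℤ) Circle} {f : Hull → ℂ}
    (hf : TopDyn.IsEigenfunction χ f) : χ = 1 := by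
  have hE : f emptyHull ≠ 0 := fun h0 => hf.ne_zero <| funext fun X => by
    have := norm_eigenfunction hf X
    rwa [h0, norm_zero, norm_eq_zero] at this
  ext t
  have h := hf.map_vadd t emptyHull
  rw [vadd_emptyHull] at h
  rw [AddChar.one_apply, Circle.coe_one]
  exact mul_right_cancel₀ hE (by rw [← h, one_mul])

theorem eigenfunction_eq {χ : AddChar (ℤ × ℤ) Circle} {f : Hull → ℂ}
    (hf : TopDyn.IsEigenfunction χ f) (X : Hull) : f X = f emptyHull := by
  by_contra hne
  have hU : {Y : Hull | f Y ≠ f X} ∈ 𝓝 emptyHull :=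
    (isOpen_ne_fun hf.continuous continuous_const).mem_nhds (Ne.symm hne)
  obtain ⟨t, ht⟩ := exists_vadd_mem_nhds_empty X hU
  refine ht ?_
  rw [hf.map_vadd, eigenvalue_eq_one hf, AddChar.one_apply, Circle.coe_one, one_mul]

theorem topologicalPointSpectrum_hull :
    TopDyn.topologicalPointSpectrum (ℤ × ℤ) Hull = {1} := by
  refine eq_singleton_iff_unique_mem.mpr ⟨⟨fun _ => 1, continuous_const, ?_, ?_⟩, ?_⟩
  · exact fun h => one_ne_zero (congrFun h emptyHull)
  · intro t X
    rw [AddChar.one_apply, Circle.coe_one, one_mul]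
  · rintro χ ⟨f, hf⟩
    exact eigenvalue_eq_one hf

/-! ### Topological ergodicity -/

/-- The finite pattern of `X` in a window, together with a translate of such a pattern of `Y`. -/
def superpose (B : Finset (ℤ × ℤ)) (X Y : Config) (t : ℤ × ℤ) : Config := fun x =>
  (decide (x ∈ B) && X x) || (decide (x - t ∈ B) && Y (x - t))

/-- The superposition has at most `2 * B.card` points, so pigeonhole settles all larger primes. At
the small ones, `X` and `t + Y` must miss a common coset. -/
theorem isAdmissible_superpose (B : Finset (ℤ × ℤ)) {X Y : Config} {t : ℤ × ℤ}
    (h : ∀ p : ℕ, p.Prime → p < 2 * B.card + 1 → ∃ g : ZMod p × ZMod p,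
      (∀ x ∈ support X, residue p x ≠ g) ∧ ∀ x ∈ support Y, residue p (x + t) ≠ g) :
    IsAdmissible (support (superpose B X Y t)) := by
  classical
  intro p hp
  by_cases hpB : p < 2 * B.card + 1
  · obtain ⟨g, hgX, hgY⟩ := h p hp hpB
    refine ⟨g, fun x hx => ?_⟩
    rw [mem_support, superpose, Bool.or_eq_true, Bool.and_eq_true, Bool.and_eq_true] at hx
    rcases hx with hx | hx
    · exact hgX x hx.2
    · simpa using hgY (x - t) hx.2
  · have : NeZero p := ⟨hp.ne_zero⟩
    have hcard : (B ∪ B.image (· + t)).card < p ^ 2 := by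
      have h1 := Finset.card_union_le B (B.image (· + t))
      have h2 := Finset.card_image_le (s := B) (f := (· + t))
      have h3 := Nat.le_self_pow two_ne_zero p
      omega
    obtain ⟨g, hg⟩ := exists_residue_notMem_image _ p hcard
    refine ⟨g, fun x hx => hg x ?_⟩
    rw [mem_support, superpose, Bool.or_eq_true, Bool.and_eq_true, Bool.and_eq_true,
      decide_eq_true_iff, decide_eq_true_iff] at hx
    rcases hx with hx | hx
    · exact Finset.mem_union_left _ hx.1
    · exact Finset.mem_union_right _ (Finset.mem_image.mpr ⟨_, hx.1, sub_add_cancel x t⟩)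

theorem isTopologicallyErgodic_hull : TopDyn.IsTopologicallyErgodic (ℤ × ℤ) Hull := by
  classical
  rintro U W hU ⟨X, hX⟩ hW ⟨Y, hY⟩
  obtain ⟨B₁, hB₁⟩ := exists_window_of_mem_nhds_hull (hU.mem_nhds hX)
  obtain ⟨B₂, hB₂⟩ := exists_window_of_mem_nhds_hull (hW.mem_nhds hY)
  let B := B₁ ∪ B₂
  obtain ⟨R, hR⟩ : ∃ R : ℕ, ∀ x ∈ B, x.1.natAbs ≤ R :=
    ⟨∑ x ∈ B, x.1.natAbs, fun x hx =>
      Finset.single_le_sum (f := fun x : ℤ × ℤ => x.1.natAbs) (fun _ _ => Nat.zero_le _) hx⟩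
  have hXa := isAdmissible_hull X
  have hYa := isAdmissible_hull Y
  choose! g hg using hXa
  choose! h hh using hYa
  let S := Nat.primesBelow (2 * B.card + 1)
  have hS : ∀ p ∈ S, p.Prime := fun p hp => Nat.prime_of_mem_primesBelow hp
  let M : ℕ := ∏ p ∈ S, p
  have hM : 0 < M := Finset.prod_pos fun p hp => (hS p hp).pos
  -- Modulo small `p`, translation by `t₀` carries the coset missed by `Y` to the one missed by `X`.
  obtain ⟨t₀, ht₀⟩ := exists_residues S hS (fun p => g p - h p)
  -- translation vectors in a coset of `Mℤ²` which move the window off itself are return times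
  have key : ∀ t : ℤ × ℤ, (M : ℤ) ∣ t.1 - t₀.1 → (M : ℤ) ∣ t.2 - t₀.2 → 2 * R < t.1.natAbs →
      (U ∩ (fun x => t +ᵥ x) '' W).Nonempty := by
    intro t h1 h2 hlt
    have hZ : superpose B X.1 Y.1 t ∈ hull := by
      refine mem_hull_iff.mpr (isAdmissible_superpose B fun p hp hpB => ⟨g p, hg p hp, ?_⟩)
      have hpS : p ∈ S := Nat.mem_primesBelow.mpr ⟨hpB, hp⟩
      have hdvd : (p : ℤ) ∣ M := by exact_mod_cast Finset.dvd_prod_of_mem (fun p : ℕ => p) hpS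
      have htp : residue p t = g p - h p := by
        rw [← ht₀ p hpS]
        exact residue_eq_iff.mpr ⟨hdvd.trans h1, hdvd.trans h2⟩
      intro x hx heq
      rw [map_add, htp] at heq
      refine hh p hp x hx ?_
      rw [← sub_eq_zero] at heq ⊢
      rw [← heq]
      abel
    have hoff : ∀ x ∈ B, x - t ∉ B ∧ x + t ∉ B := by
      intro x hx
      have hx' := hR x hx
      constructor
      · intro h'
        have := hR _ h'
        rw [Prod.fst_sub] at this
        omega
      · intro h'
        have := hR _ h'
        rw [Prod.fst_add] at this
        omega
    refine ⟨⟨_, hZ⟩, hB₁ _ fun x hx => ?_, -t +ᵥ ⟨_, hZ⟩, hB₂ _ fun x hx => ?_,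
      vadd_neg_vadd t _⟩
    · have hxB : x ∈ B := Finset.mem_union_left _ hx
      simp [superpose, hxB, (hoff x hxB).1]
    · have hxB : x ∈ B := Finset.mem_union_right _ hx
      rw [hull_vadd_apply, sub_neg_eq_add]
      simp [superpose, hxB, (hoff x hxB).2]
  have hM' : (0 : ℤ) < M := by exact_mod_cast hM
  let I : Finset ℤ := Finset.Ico 0 (M : ℤ)
  -- The first square reaches the coset `t₀ + Mℤ²`. If the first coordinate then lies in `[-2R,
  -- 2R]`, the shift by `M(4R + 1) ≥ 4R + 1` stays in the coset and pushes it beyond `2R`.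
  refine ⟨(I ×ˢ I) ∪ (I.image (· + (M : ℤ) * (4 * R + 1))) ×ˢ I, fun s => ?_⟩
  have hmem : ∀ a : ℤ, a % (M : ℤ) ∈ I := fun a =>
    Finset.mem_Ico.mpr ⟨Int.emod_nonneg _ hM'.ne', Int.emod_lt_of_pos _ hM'⟩
  have hmod : ∀ a b : ℤ, (M : ℤ) ∣ (a - b) % M + b - a := fun a b => by
    rw [← Int.emod_add_mul_ediv (a - b) M]
    refine ⟨-((a - b) / M), ?_⟩
    rw [Int.add_mul_emod_self_left, Int.emod_emod_of_dvd _ dvd_rfl]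
    linarith [Int.emod_add_mul_ediv (a - b) M]
  by_cases hfar : 2 * R < ((t₀.1 - s.1) % M + s.1).natAbs
  · exact ⟨((t₀.1 - s.1) % M, (t₀.2 - s.2) % M),
      Finset.mem_union_left _ (Finset.mem_product.mpr ⟨hmem _, hmem _⟩),
      key _ (hmod _ _) (hmod _ _) hfar⟩
  · refine ⟨((t₀.1 - s.1) % M + M * (4 * R + 1), (t₀.2 - s.2) % M),
      Finset.mem_union_right _ (Finset.mem_product.mpr
        ⟨Finset.mem_image_of_mem _ (hmem _), hmem _⟩), key _ ?_ (hmod _ _) ?_⟩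
    · have := (hmod t₀.1 s.1).add (dvd_mul_right (M : ℤ) (4 * R + 1))
      rw [Prod.fst_add]
      convert! this using 1
      ring
    · have h1 : (4 * R + 1 : ℤ) ≤ M * (4 * R + 1) := le_mul_of_one_le_left (by omega) hM'
      rw [Prod.fst_add]
      generalize (M : ℤ) * (4 * R + 1) = K at h1 ⊢
      omega

/-! ### The rotation, the joining, and the failure of weak mixing -/

instance : T2Space KGroup :=
  inferInstanceAs (T2Space (∀ p : Nat.Primes, ZMod (p : ℕ) × ZMod (p : ℕ)))

instance : CompactSpace KGroup :=
  have (p : Nat.Primes) : NeZero (p : ℕ) := ⟨p.2.ne_zero⟩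
  inferInstanceAs (CompactSpace (∀ p : Nat.Primes, ZMod (p : ℕ) × ZMod (p : ℕ)))

theorem kgroup_vadd_apply (x : ℤ × ℤ) (g : KGroup) (p : Nat.Primes) :
    (x +ᵥ g) p = g p + residue p x := rfl

theorem continuous_kgroup_apply (p : Nat.Primes) : Continuous fun g : KGroup => g p :=
  continuous_apply (A := fun p : Nat.Primes => ZMod (p : ℕ) × ZMod (p : ℕ)) p

/-- Neighbourhoods in `∏_p (ℤ/p)²` contain cylinder sets. -/
theorem exists_primes_of_mem_nhds {g : KGroup} {U : Set KGroup} (hU : U ∈ 𝓝 g) :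
    ∃ S : Finset Nat.Primes, ∀ h : KGroup, (∀ p ∈ S, h p = g p) → h ∈ U := by
  obtain ⟨V, hVU, hV, hg⟩ := mem_nhds_iff.mp hU
  obtain ⟨S, u, hu, hS⟩ := isOpen_pi_iff.mp
    (show IsOpen (X := ∀ p : Nat.Primes, ZMod (p : ℕ) × ZMod (p : ℕ)) V from hV) g hg
  refine ⟨S, fun h hh => hVU (hS ?_)⟩
  intro p hp
  rw [show h p = g p from hh p hp]
  exact (hu p hp).2

theorem isMinimal_kgroup : AddAction.IsMinimal (ℤ × ℤ) KGroup := by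
  classical
  refine ⟨fun g h => mem_closure_iff_nhds.mpr fun U hU => ?_⟩
  obtain ⟨S, hS⟩ := exists_primes_of_mem_nhds hU
  obtain ⟨t, ht⟩ := exists_residues (S.image (fun p : Nat.Primes => (p : ℕ)))
    (by rintro _ hp
        obtain ⟨p, -, rfl⟩ := Finset.mem_image.mp hp
        exact p.2)
    (fun p => if hp : p.Prime then h ⟨p, hp⟩ - g ⟨p, hp⟩ else 0)
  refine ⟨_, hS (t +ᵥ g) fun p hp => ?_, ⟨t, rfl⟩⟩
  have := ht p (Finset.mem_image_of_mem _ hp)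
  rw [dif_pos p.2] at this
  rw [kgroup_vadd_apply, this]
  exact add_sub_cancel (g p) (h p)

/-- A neighbourhood of the diagonal contains all pairs of points with the same coordinates at
finitely many primes. -/
theorem exists_primes_of_mem_nhdsSet_diagonal {U : Set (KGroup × KGroup)}
    (hU : U ∈ 𝓝ˢ (diagonal KGroup)) :
    ∃ S : Finset Nat.Primes, ∀ g h : KGroup, (∀ p ∈ S, h p = g p) → (g, h) ∈ U := by
  classical
  have hloc : ∀ g : KGroup, ∃ S : Finset Nat.Primes, ∀ h k : KGroup,
      (∀ p ∈ S, h p = g p) → (∀ p ∈ S, k p = g p) → (h, k) ∈ U := by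
    intro g
    have hg : U ∈ 𝓝 (g, g) := nhds_le_nhdsSet (mem_diagonal g) hU
    obtain ⟨V, hV, W, hW, hVW⟩ := mem_nhds_prod_iff.mp hg
    obtain ⟨S, hS⟩ := exists_primes_of_mem_nhds hV
    obtain ⟨T, hT⟩ := exists_primes_of_mem_nhds hW
    exact ⟨S ∪ T, fun h k hh hk => hVW ⟨hS _ fun p hp => hh p (Finset.mem_union_left _ hp),
      hT _ fun p hp => hk p (Finset.mem_union_right _ hp)⟩⟩
  choose S hS using hloc
  obtain ⟨F, hF⟩ := isCompact_univ.elim_finite_subcover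
    (fun g : KGroup => ⋂ p ∈ S g, {h : KGroup | h p = g p})
    (fun g => isOpen_biInter_finset fun p _ =>
      (isOpen_discrete {g p}).preimage (continuous_kgroup_apply p))
    (fun g _ => mem_iUnion.mpr ⟨g, mem_iInter₂.mpr fun _ _ => rfl⟩)
  refine ⟨F.biUnion S, fun g h hgh => ?_⟩
  obtain ⟨k, hk, hgk⟩ := mem_iUnion₂.mp (hF (mem_univ g))
  rw [mem_iInter₂] at hgk
  exact hS k g h hgk fun p hp =>
    (hgh p (Finset.mem_biUnion.mpr ⟨k, hk, hp⟩)).trans (hgk p hp)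

theorem isKronecker_kgroup : TopDyn.IsKronecker (ℤ × ℤ) KGroup where
  compact := inferInstance
  hausdorff := inferInstance
  continuous_vadd := ⟨fun t => continuous_pi
    (X := ∀ p : Nat.Primes, ZMod (p : ℕ) × ZMod (p : ℕ)) fun p =>
      (continuous_kgroup_apply p).add continuous_const⟩
  minimal := isMinimal_kgroup
  equicontinuous := fun U hU g => by
    obtain ⟨S, hS⟩ := exists_primes_of_mem_nhdsSet_diagonal hU
    have hev : ∀ᶠ h in 𝓝 g, ∀ p ∈ S, h p = g p := (Filter.eventually_all_finset S).mpr fun p _ =>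
      (continuous_kgroup_apply p).continuousAt.eventually
        ((isOpen_discrete {g p}).mem_nhds rfl)
    filter_upwards [hev] with h hh t
    -- Rotations preserve agreement at the primes of `S`, so the neighbourhood is uniform in `t`.
    exact hS _ _ fun p hp => by rw [kgroup_vadd_apply, kgroup_vadd_apply, hh p hp]

/-- The pairs `(X, g)` such that `X` misses the coset of `pℤ²` given by `g`, for each prime `p`. -/
def missedCosets : Set (Hull × KGroup) :=
  {w | ∀ (p : Nat.Primes) (x : ℤ × ℤ), w.1.1 x = true → residue p x ≠ w.2 p}

theorem isJoining_missedCosets : TopDyn.IsJoining (ℤ × ℤ) missedCosets where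
  closed := by
    have : missedCosets = ⋂ (p : Nat.Primes) (x : ℤ × ℤ),
        {w : Hull × KGroup | w.1.1 x = false} ∪ {w | w.2 p = residue p x}ᶜ := by
      ext w
      simp only [missedCosets, mem_iInter, mem_union, mem_compl_iff, mem_ofPred_eq,
        ← Bool.not_eq_true, imp_iff_not_or, ne_eq, @eq_comm _ (residue _ _)]
    rw [this]
    refine isClosed_iInter fun p => isClosed_iInter fun x => IsClosed.union ?_ ?_
    · exact isClosed_eq ((continuous_eval x).comp (continuous_subtype_val.comp continuous_fst))
        continuous_const
    · exact ((isOpen_discrete {residue p x}).preimage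
        ((continuous_kgroup_apply p).comp continuous_snd)).isClosed_compl
  invariant := by
    rintro t ⟨X, g⟩ hw p x hx heq
    refine hw p (x - t) hx ?_
    rw [map_sub, heq]
    exact add_sub_cancel_right (g p) (residue p t)
  fst_surj := by
    refine eq_univ_of_forall fun X => ?_
    choose! g hg using isAdmissible_hull X
    exact ⟨(X, fun p => g p), fun p x hx => hg p p.2 x hx, rfl⟩
  snd_surj := by
    refine eq_univ_of_forall fun g => ⟨(emptyHull, g), fun p x hx => ?_, rfl⟩
    exact absurd hx Bool.false_ne_true

/-- The set of visible points as an element of the hull. -/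
def visibleHull : Hull := ⟨visible, mem_hull_iff.mpr isAdmissible_visible⟩

theorem missedCosets_ne_univ : missedCosets ≠ univ := fun h => by
  have hw : (visibleHull, iota (1, 0)) ∈ missedCosets := h ▸ mem_univ _
  exact hw ⟨2, Nat.prime_two⟩ (1, 0) (by decide +kernel) rfl

/-- A configuration in the hull that contains representatives of three cosets of `2ℤ²` misses the
fourth one. -/
theorem forall_residue_two_ne {X : Hull} {a : ℤ × ℤ} (h₁ : X.1 (a + (1, 0)) = true)
    (h₂ : X.1 (a + (0, 1)) = true) (h₃ : X.1 (a + (1, 1)) = true) :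
    ∀ x, X.1 x = true → residue 2 x ≠ residue 2 a := by
  obtain ⟨g, hg⟩ := isAdmissible_hull X 2 Nat.prime_two
  have key : ∀ g a : ZMod 2 × ZMod 2, a + (1, 0) ≠ g → a + (0, 1) ≠ g → a + (1, 1) ≠ g →
      g = a := by decide
  have e₁ := hg _ h₁
  have e₂ := hg _ h₂
  have e₃ := hg _ h₃
  rw [map_add] at e₁ e₂ e₃
  rw [← key g (residue 2 a) e₁ e₂ e₃]
  exact hg

/-- A configuration in `A a` misses precisely the class of `a` modulo 2. A return time for the two
products would carry class `0` both to `0` and to `(1, 0)`. -/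
theorem not_isTopologicallyWeaklyMixing_hull :
    ¬ TopDyn.IsTopologicallyWeaklyMixing (ℤ × ℤ) Hull := by
  intro h
  let A (a : ℤ × ℤ) : Set Hull :=
    {X | X.1 (a + (1, 0)) = true ∧ X.1 (a + (0, 1)) = true ∧ X.1 (a + (1, 1)) = true}
  have hA : ∀ a, IsOpen (A a) := by
    have hx : ∀ x : ℤ × ℤ, IsOpen {X : Hull | X.1 x = true} := fun x =>
      (isOpen_discrete {true}).preimage ((continuous_eval x).comp continuous_subtype_val)
    exact fun a => (hx _).inter ((hx _).inter (hx _))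
  have h0 : visibleHull ∈ A 0 := by
    refine ⟨?_, ?_, ?_⟩ <;> decide +kernel
  have h1 : ((1, 0) : ℤ × ℤ) +ᵥ visibleHull ∈ A (1, 0) := by
    refine ⟨?_, ?_, ?_⟩ <;> decide +kernel
  obtain ⟨t, ⟨X, Y⟩, ⟨⟨X', Y'⟩, ⟨hX', hY'⟩, heq⟩, hX, hY⟩ :=
    h.exists_vadd_inter ((hA 0).prod (hA 0)) ⟨(_, _), h0, h0⟩
      ((hA 0).prod (hA (1, 0))) ⟨(_, _), h0, h1⟩
  obtain ⟨rfl, rfl⟩ := Prod.ext_iff.mp heq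
  have shift : ∀ (Z : Hull) (y : ℤ × ℤ), Z ∈ A 0 →
      t +ᵥ Z ∈ A y → residue 2 t = residue 2 y := by
    intro Z y hZ hZy
    have e := forall_residue_two_ne hZ.1 hZ.2.1 hZ.2.2
    have e' := forall_residue_two_ne hZy.1 hZy.2.1 hZy.2.2
    have key : ∀ d : ZMod 2 × ZMod 2, d + (1, 0) ≠ 0 → d + (0, 1) ≠ 0 → d + (1, 1) ≠ 0 →
        d = 0 := by decide
    rw [map_zero] at e
    have f₁ := e _ hZy.1
    have f₂ := e _ hZy.2.1
    have f₃ := e _ hZy.2.2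
    simp only [map_sub, map_add] at f₁ f₂ f₃
    refine (sub_eq_zero.mp (key (residue 2 y - residue 2 t) ?_ ?_ ?_)).symm
    · rwa [sub_add_eq_add_sub]
    · rwa [sub_add_eq_add_sub]
    · rwa [sub_add_eq_add_sub]
  have := (shift X' 0 hX' hX).symm.trans (shift Y' (1, 0) hY' hY)
  exact absurd this (by decide)

/-! ### Counting points outside prescribed cosets -/

/-- The product `∏_{p < L} (ℤ/p)²`. -/
abbrev Residues (L : ℕ) : Type := ∀ p : Nat.primesBelow L, ZMod (p : ℕ) × ZMod (p : ℕ)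

instance (L : ℕ) (p : Nat.primesBelow L) : NeZero (p : ℕ) :=
  ⟨(Nat.prime_of_mem_primesBelow p.2).ne_zero⟩

/-- The residues of a lattice point modulo the primes below `L`. -/
def residues (L : ℕ) (x : ℤ × ℤ) : Residues L := fun p => residue p x

/-- The points of `F` which avoid the cosets given by `g`. -/
def avoiding {L : ℕ} (F : Finset (ℤ × ℤ)) (g : Residues L) : Finset (ℤ × ℤ) :=
  F.filter fun x => ∀ p : Nat.primesBelow L, residue p x ≠ g p

theorem mem_avoiding {L : ℕ} {F : Finset (ℤ × ℤ)} {g : Residues L} {x : ℤ × ℤ} :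
    x ∈ avoiding F g ↔ x ∈ F ∧ ∀ p : Nat.primesBelow L, residue p x ≠ g p :=
  Finset.mem_filter

theorem card_filter_forall_ne {L : ℕ} (g : Residues L) :
    (Finset.univ.filter fun h : Residues L => ∀ p, h p ≠ g p).card =
      ∏ p ∈ Nat.primesBelow L, (p ^ 2 - 1) := by
  have : (Finset.univ.filter fun h : Residues L => ∀ p, h p ≠ g p) =
      Fintype.piFinset fun p => Finset.univ.erase (g p) := by
    ext h
    simp [Fintype.mem_piFinset]
  rw [this, Fintype.card_piFinset, ← Finset.prod_coe_sort (Nat.primesBelow L)]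
  refine Finset.prod_congr rfl fun p _ => ?_
  rw [Finset.card_erase_of_mem (Finset.mem_univ _), Finset.card_univ, Fintype.card_prod,
    ZMod.card, sq]

theorem card_residues (L : ℕ) :
    Fintype.card (Residues L) = ∏ p ∈ Nat.primesBelow L, p ^ 2 := by
  rw [Fintype.card_pi, ← Finset.prod_coe_sort (Nat.primesBelow L)]
  exact Finset.prod_congr rfl fun p _ => by rw [Fintype.card_prod, ZMod.card, sq]

/-- Double counting: a given point is avoided by `p ^ 2 - 1` of the cosets at each `p`,
independently. -/
theorem sum_card_avoiding (L : ℕ) (F : Finset (ℤ × ℤ)) :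
    ∑ g : Residues L, (avoiding F g).card = F.card * ∏ p ∈ Nat.primesBelow L, (p ^ 2 - 1) := by
  have h := Finset.sum_card_bipartiteAbove_eq_sum_card_bipartiteBelow (s := Finset.univ) (t := F)
    (fun (g : Residues L) x => ∀ p : Nat.primesBelow L, residue p x ≠ g p)
  refine h.trans ?_
  rw [Finset.sum_const_nat (m := ∏ p ∈ Nat.primesBelow L, (p ^ 2 - 1))]
  intro x _
  rw [← card_filter_forall_ne (residues L x)]
  refine congrArg Finset.card (Finset.filter_congr fun g _ => forall_congr' fun p => ?_)
  exact ne_comm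

/-- The interval `[a, a + kM)`, with `M` the product of the primes below `L`, contains exactly `k`
elements with given residues modulo these primes. -/
theorem card_filter_intCast_eq (L : ℕ) (c : ∀ p : Nat.primesBelow L, ZMod (p : ℕ)) (a : ℤ)
    (k : ℕ) :
    ((Finset.Ico a (a + k * (∏ p ∈ Nat.primesBelow L, p : ℕ))).filter fun x : ℤ =>
      ∀ p : Nat.primesBelow L, (x : ZMod (p : ℕ)) = c p).card = k := by
  obtain ⟨v, hv⟩ := exists_int_residues (Nat.primesBelow L)
    (fun p hp => Nat.prime_of_mem_primesBelow hp)
    (fun p => if hp : p ∈ Nat.primesBelow L then c ⟨p, hp⟩ else 0)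
  set M : ℕ := ∏ p ∈ Nat.primesBelow L, p with hM
  have hMpos : (0 : ℤ) < M := by
    exact_mod_cast Finset.prod_pos fun p hp => (Nat.prime_of_mem_primesBelow hp).pos
  have hiff : ∀ x : ℤ, (∀ p : Nat.primesBelow L, (x : ZMod (p : ℕ)) = c p) ↔
      x ≡ v [ZMOD (M : ℤ)] := by
    intro x
    have hvp : ∀ p : Nat.primesBelow L, (v : ZMod (p : ℕ)) = c p := fun p => by
      rw [hv p p.2, dif_pos p.2]
    have hxp : ∀ p : Nat.primesBelow L, (x : ZMod (p : ℕ)) = c p ↔ ((p : ℕ) : ℤ) ∣ v - x :=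
      fun p => by rw [← hvp, ZMod.intCast_eq_intCast_iff_dvd_sub]
    rw [forall_congr' hxp, Int.modEq_iff_dvd]
    constructor
    · intro h
      rw [hM, Nat.cast_prod]
      refine Finset.prod_dvd_of_coprime (fun p hp q hq hpq => ?_) fun p hp => h ⟨p, hp⟩
      exact ((Nat.coprime_primes (Nat.prime_of_mem_primesBelow hp)
        (Nat.prime_of_mem_primesBelow hq)).mpr hpq).isCoprime
    · intro h p
      have : ((p : ℕ) : ℤ) ∣ M := by
        exact_mod_cast Finset.dvd_prod_of_mem (fun p : ℕ => p) p.2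
      exact this.trans h
  simp_rw [hiff]
  have hcard := Int.Ico_filter_modEq_card a (a + k * M) hMpos v
  have hMQ : ((M : ℤ) : ℚ) ≠ 0 := by exact_mod_cast hMpos.ne'
  -- The count is a difference of two ceilings whose arguments differ by the integer `k`.
  have hshift : (((a + k * M : ℤ) : ℚ) - v) / ((M : ℤ) : ℚ) = (a - v) / ((M : ℤ) : ℚ) + (k : ℤ) := by
    push_cast at hMQ ⊢
    field_simp
    ring
  rw [hshift, Int.ceil_add_intCast, add_sub_cancel_left, max_eq_left (Int.natCast_nonneg k)]
    at hcard
  exact_mod_cast hcard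

/-- The square `[a, a + m)²`. -/
def square (a : ℤ) (m : ℕ) : Finset (ℤ × ℤ) := Finset.Ico a (a + m) ×ˢ Finset.Ico a (a + m)

/-- The side is a multiple of `∏ p`, so each residue vector occurs exactly `k ^ 2` times; the count
is exact and independent of `g` and `a`. -/
theorem card_avoiding_square (L : ℕ) (g : Residues L) (a : ℤ) (k : ℕ) :
    (avoiding (square a (k * ∏ p ∈ Nat.primesBelow L, p)) g).card =
      k ^ 2 * ∏ p ∈ Nat.primesBelow L, (p ^ 2 - 1) := by
  rw [← card_filter_forall_ne g, Finset.card_eq_sum_card_fiberwise (f := residues L)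
    (t := Finset.univ.filter fun h : Residues L => ∀ p, h p ≠ g p), Finset.sum_const_nat (m := k ^ 2),
    mul_comm]
  · intro h hh
    have hfib : (avoiding (square a (k * ∏ p ∈ Nat.primesBelow L, p)) g).filter
        (fun x => residues L x = h) =
        ((Finset.Ico a (a + k * (∏ p ∈ Nat.primesBelow L, p : ℕ))).filter fun x : ℤ =>
          ∀ p : Nat.primesBelow L, (x : ZMod (p : ℕ)) = (h p).1) ×ˢ
        ((Finset.Ico a (a + k * (∏ p ∈ Nat.primesBelow L, p : ℕ))).filter fun x : ℤ =>
          ∀ p : Nat.primesBelow L, (x : ZMod (p : ℕ)) = (h p).2) := by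
      ext x
      simp only [Finset.mem_filter, mem_avoiding, Finset.mem_product, square, Nat.cast_mul]
      constructor
      · rintro ⟨⟨hx, -⟩, rfl⟩
        exact ⟨⟨hx.1, fun p => rfl⟩, hx.2, fun p => rfl⟩
      · rintro ⟨⟨hx1, h1⟩, hx2, h2⟩
        have hxh : residues L x = h := funext fun p => Prod.ext (h1 p) (h2 p)
        refine ⟨⟨⟨hx1, hx2⟩, fun p => ?_⟩, hxh⟩
        subst hxh
        exact (Finset.mem_filter.mp hh).2 p
    rw [hfib, Finset.card_product, card_filter_intCast_eq, card_filter_intCast_eq, sq]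
  · intro x hx
    exact Finset.mem_filter.mpr ⟨Finset.mem_univ _, (mem_avoiding.mp hx).2⟩

/-! ### Counting patterns -/

open Classical in
/-- The admissible subsets of a finite window. -/
def patterns (F : Finset (ℤ × ℤ)) : Finset (Finset (ℤ × ℤ)) :=
  F.powerset.filter fun P => IsAdmissible (P : Set (ℤ × ℤ))

theorem mem_patterns {F P : Finset (ℤ × ℤ)} :
    P ∈ patterns F ↔ P ⊆ F ∧ IsAdmissible (P : Set (ℤ × ℤ)) := by
  classical
  rw [patterns, Finset.mem_filter, Finset.mem_powerset]

/-- Every admissible pattern is a subset of `avoiding F g` for some `g`. -/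
theorem card_patterns_square_le (L : ℕ) (a : ℤ) (k : ℕ) :
    (patterns (square a (k * ∏ p ∈ Nat.primesBelow L, p))).card ≤
      Fintype.card (Residues L) * 2 ^ (k ^ 2 * ∏ p ∈ Nat.primesBelow L, (p ^ 2 - 1)) := by
  classical
  set F := square a (k * ∏ p ∈ Nat.primesBelow L, p)
  have hsub : patterns F ⊆ Finset.univ.biUnion fun g : Residues L => (avoiding F g).powerset := by
    intro P hP
    obtain ⟨hPF, hPa⟩ := mem_patterns.mp hP
    choose! g hg using hPa
    refine Finset.mem_biUnion.mpr ⟨fun p => g p, Finset.mem_univ _, Finset.mem_powerset.mpr ?_⟩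
    exact fun x hx => mem_avoiding.mpr
      ⟨hPF hx, fun p => hg p (Nat.prime_of_mem_primesBelow p.2) x hx⟩
  refine (Finset.card_le_card hsub).trans (Finset.card_biUnion_le_card_mul _ _ _ fun g _ => ?_)
  rw [Finset.card_powerset, card_avoiding_square]

/-- The proportion of points avoiding one coset of `pℤ²` for each prime `p < L`. -/
def avoidingDensity (L : ℕ) : ℝ := ∏ p ∈ Nat.primesBelow L, (1 - 1 / (p : ℝ) ^ 2)

theorem cast_prod_sq_sub_one (L : ℕ) :
    ((∏ p ∈ Nat.primesBelow L, (p ^ 2 - 1) : ℕ) : ℝ) =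
      ((∏ p ∈ Nat.primesBelow L, p : ℕ) : ℝ) ^ 2 * avoidingDensity L := by
  rw [avoidingDensity, Nat.cast_prod, Nat.cast_prod, ← Finset.prod_pow, ← Finset.prod_mul_distrib]
  refine Finset.prod_congr rfl fun p hp => ?_
  have hp := (Nat.prime_of_mem_primesBelow hp)
  have hp0 : (p : ℝ) ≠ 0 := by exact_mod_cast hp.ne_zero
  rw [Nat.cast_sub (Nat.one_le_pow _ _ hp.pos)]
  push_cast
  field_simp

theorem avoidingDensity_nonneg (L : ℕ) : 0 ≤ avoidingDensity L :=
  Finset.prod_nonneg fun p hp => by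
    have hp : (1 : ℝ) ≤ p := by exact_mod_cast (Nat.prime_of_mem_primesBelow hp).pos
    rw [sub_nonneg, div_le_one (by positivity)]
    exact one_le_pow₀ hp

/-- These are the inverses of the partial Euler products of `ζ(2) = π²/6`. -/
theorem tendsto_avoidingDensity : Tendsto avoidingDensity atTop (𝓝 (6 / Real.pi ^ 2)) := by
  let f : ℕ →*₀ ℝ :=
    { toFun := fun n => 1 / (n : ℝ) ^ 2
      map_zero' := by simp
      map_one' := by simp
      map_mul' := fun m n => by push_cast; rw [mul_pow, one_div_mul_one_div] }
  have hsum : Summable fun n => ‖f n‖ := hasSum_zeta_two.summable.norm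
  have h := EulerProduct.eulerProduct_completely_multiplicative hsum
  rw [show ∑' n, f n = Real.pi ^ 2 / 6 from hasSum_zeta_two.tsum_eq] at h
  have h' := h.inv₀ (by positivity)
  rw [inv_div] at h'
  refine h'.congr fun L => ?_
  rw [← Finset.prod_inv_distrib]
  exact Finset.prod_congr rfl fun p _ => inv_inv _

/-- By averaging over all choices of cosets, windows contain large admissible sets. -/
theorem exists_card_avoiding_ge (L : ℕ) (F : Finset (ℤ × ℤ)) :
    ∃ g : Residues L, F.card * avoidingDensity L ≤ (avoiding F g).card := by
  have hne : (Finset.univ : Finset (Residues L)).Nonempty := ⟨residues L 0, Finset.mem_univ _⟩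
  obtain ⟨g, -, hg⟩ := Finset.exists_le_of_sum_le
    (f := fun _ : Residues L => (F.card : ℝ) * avoidingDensity L)
    (g := fun g : Residues L => ((avoiding F g).card : ℝ)) hne (by
      rw [Finset.sum_const, Finset.card_univ, card_residues, ← Nat.cast_sum, sum_card_avoiding,
        Nat.cast_mul, cast_prod_sq_sub_one, nsmul_eq_mul, Finset.prod_pow]
      push_cast
      exact le_of_eq (by ring))
  exact ⟨g, hg⟩

/-- All subsets of `avoiding F g` are admissible: `g` serves the primes below `L`, and for `p ≥ L`
the window has too few points to meet all `p ^ 2` cosets. -/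
theorem two_pow_le_card_patterns {L : ℕ} {F : Finset (ℤ × ℤ)} (hF : F.card < L ^ 2)
    (g : Residues L) : 2 ^ (avoiding F g).card ≤ (patterns F).card := by
  rw [← Finset.card_powerset]
  refine Finset.card_le_card fun P hP => ?_
  have hP := Finset.mem_powerset.mp hP
  have hPF : P ⊆ F := hP.trans (Finset.filter_subset _ _)
  refine mem_patterns.mpr ⟨hPF, fun p hp => ?_⟩
  by_cases hpL : p < L
  · exact ⟨g ⟨p, Nat.mem_primesBelow.mpr ⟨hpL, hp⟩⟩, fun x hx => (mem_avoiding.mp (hP hx)).2 ⟨p, _⟩⟩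
  · have : NeZero p := ⟨hp.ne_zero⟩
    exact exists_residue_notMem_image P p ((Finset.card_le_card hPF).trans_lt
      (hF.trans_le (Nat.pow_le_pow_left (not_lt.mp hpL) 2)))

/-! ### Patterns and open covers -/

/-- The configuration of a finite set. -/
def finsetConfig (P : Finset (ℤ × ℤ)) : Config := fun x => decide (x ∈ P)

theorem finsetConfig_mem_hull {F P : Finset (ℤ × ℤ)} (hP : P ∈ patterns F) :
    finsetConfig P ∈ hull :=
  mem_hull_iff.mpr ((mem_patterns.mp hP).2.mono fun _ hx => of_decide_eq_true hx)

/-- Lebesgue number lemma for the hull: every open cover is refined by the cylinder sets of some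
window. -/
theorem exists_window_of_isOpenCover {𝒰 : Set (Set Hull)} (h𝒰 : TopDyn.IsOpenCover 𝒰) :
    ∃ B : Finset (ℤ × ℤ), ∀ X : Hull, ∃ U ∈ 𝒰, ∀ Y : Hull, (∀ x ∈ B, Y.1 x = X.1 x) → Y ∈ U := by
  classical
  have hloc : ∀ X : Hull, ∃ B : Finset (ℤ × ℤ), ∃ U ∈ 𝒰,
      ∀ Y : Hull, (∀ x ∈ B, Y.1 x = X.1 x) → Y ∈ U := by
    intro X
    obtain ⟨U, hU, hXU⟩ := mem_sUnion.mp (h𝒰.covers ▸ mem_univ X)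
    obtain ⟨B, hB⟩ := exists_window_of_mem_nhds_hull ((h𝒰.isOpen U hU).mem_nhds hXU)
    exact ⟨B, U, hU, hB⟩
  choose B U hU hB using hloc
  obtain ⟨T, hT⟩ := isCompact_univ.elim_finite_subcover
    (fun X : Hull => ⋂ x ∈ B X, {Y : Hull | Y.1 x = X.1 x})
    (fun X => isOpen_biInter_finset fun x _ => (isOpen_discrete {X.1 x}).preimage
      ((continuous_eval x).comp continuous_subtype_val))
    (fun X _ => mem_iUnion.mpr ⟨X, mem_iInter₂.mpr fun _ _ => rfl⟩)
  refine ⟨T.biUnion B, fun X => ?_⟩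
  obtain ⟨Z, hZ, hXZ⟩ := mem_iUnion₂.mp (hT (mem_univ X))
  rw [mem_iInter₂] at hXZ
  exact ⟨U Z, hU Z, fun Y hY => hB Z Y fun x hx =>
    (hY x (Finset.mem_biUnion.mpr ⟨Z, hZ, hx⟩)).trans (hXZ x hx)⟩

/-- The common refinement of translates of an open cover has a subcover that is no larger than the
number of patterns in a slightly larger window. -/
theorem exists_subcover_card_le {𝒰 : Set (Set Hull)} (h𝒰 : TopDyn.IsOpenCover 𝒰) :
    ∃ r : ℕ, ∀ n m : ℕ, n + 2 * r + 1 ≤ m → ∃ s : Finset (Set Hull),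
      (s : Set (Set Hull)) ⊆ TopDyn.joinCover (TopDyn.box n) 𝒰 ∧
      ⋃₀ (s : Set (Set Hull)) = univ ∧
      s.card ≤ (patterns (square (-(n + r : ℕ)) m)).card := by
  classical
  obtain ⟨B, hB⟩ := exists_window_of_isOpenCover h𝒰
  choose U hU hBU using hB
  obtain ⟨r, hr⟩ : ∃ r : ℕ, ∀ x ∈ B, x.1.natAbs + x.2.natAbs ≤ r :=
    ⟨∑ x ∈ B, (x.1.natAbs + x.2.natAbs), fun x hx => Finset.single_le_sum
      (f := fun x : ℤ × ℤ => x.1.natAbs + x.2.natAbs) (fun _ _ => Nat.zero_le _) hx⟩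
  refine ⟨r, fun n m hm => ?_⟩
  -- Contains every `x - t` with `x ∈ B` and `t` in the box. Its side `m` stays free so that it can
  -- later be a multiple of `∏ p`.
  set F := square (-(n + r : ℕ)) m with hF
  have hBF : ∀ x ∈ B, ∀ t ∈ TopDyn.box n, x - t ∈ F := by
    intro x hx t ht
    have h1 := hr x hx
    simp only [TopDyn.box, Finset.mem_product, Finset.mem_Ico] at ht
    simp only [hF, square, Finset.mem_product, Finset.mem_Ico, Prod.fst_sub, Prod.snd_sub]
    omega
  let Z : patterns F → Hull := fun P => ⟨finsetConfig P, finsetConfig_mem_hull P.2⟩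
  let A : patterns F → Set Hull := fun P => ⋂ t ∈ TopDyn.box n, (fun X : Hull => t +ᵥ X) ⁻¹'
    U (t +ᵥ Z P)
  refine ⟨Finset.univ.image A, ?_, ?_, ?_⟩
  · intro V hV
    obtain ⟨P, -, rfl⟩ := Finset.mem_image.mp hV
    exact ⟨fun t => U (t +ᵥ Z P), fun t _ => hU _, rfl⟩
  · refine eq_univ_of_forall fun Y => ?_
    have hP : F.filter (fun x => Y.1 x = true) ∈ patterns F :=
      mem_patterns.mpr ⟨Finset.filter_subset _ _, (isAdmissible_hull Y).mono fun x hx =>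
        (Finset.mem_filter.mp hx).2⟩
    refine mem_sUnion.mpr ⟨A ⟨_, hP⟩, Finset.mem_image_of_mem _ (Finset.mem_univ _), ?_⟩
    refine mem_iInter₂.mpr fun t ht => hBU _ _ fun x hx => ?_
    rw [hull_vadd_apply, hull_vadd_apply]
    simp [Z, finsetConfig, hBF x hx t ht]
  · exact Finset.card_image_le.trans_eq (by rw [Finset.card_univ, Fintype.card_coe])

/-- The partition of the hull according to the value at the origin. -/
def originCover : Set (Set Hull) := range fun b : Bool => {X : Hull | X.1 0 = b}

theorem isOpenCover_originCover : TopDyn.IsOpenCover originCover where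
  isOpen := by
    rintro _ ⟨b, rfl⟩
    exact (isOpen_discrete {b}).preimage ((continuous_eval 0).comp continuous_subtype_val)
  covers := eq_univ_of_forall fun X => mem_sUnion.mpr ⟨_, ⟨X.1 0, rfl⟩, rfl⟩

/-- A member of the refined cover prescribes the values at all `-t` with `t` in the box, hence
contains at most one of the configurations `finsetConfig P`. -/
theorem card_patterns_le_minSubcover (n : ℕ) :
    (patterns ((TopDyn.box n).image Neg.neg)).card ≤
      TopDyn.minSubcover (TopDyn.joinCover (TopDyn.box n) originCover) := by
  classical
  -- A finite subcover must be exhibited, since `sInf ∅ = 0` in `ℕ`.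
  obtain ⟨r, hr⟩ := exists_subcover_card_le isOpenCover_originCover
  obtain ⟨s₀, hs₀, hs₀', -⟩ := hr n _ le_rfl
  refine le_csInf ⟨_, s₀, hs₀, hs₀', rfl⟩ ?_
  rintro _ ⟨s, hs, hs', rfl⟩
  have hA : ∀ P : patterns ((TopDyn.box n).image Neg.neg), ∃ A ∈ s,
      (⟨finsetConfig P, finsetConfig_mem_hull P.2⟩ : Hull) ∈ A := fun P =>
    mem_sUnion.mp (hs' ▸ mem_univ _)
  choose A hAs hA using hA
  rw [← Fintype.card_coe, ← Fintype.card_coe s]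
  refine Fintype.card_le_of_injective (fun P => (⟨A P, hAs P⟩ : s)) fun P Q hPQ => ?_
  have hAPQ : A P = A Q := congrArg Subtype.val hPQ
  have hP := hA P
  have hQ := hA Q
  rw [← hAPQ] at hQ
  obtain ⟨c, hc, hAc⟩ := hs (hAs P)
  rw [hAc, mem_iInter₂] at hP hQ
  have hiff : ∀ x ∈ (TopDyn.box n).image Neg.neg, x ∈ P.1 ↔ x ∈ Q.1 := by
    intro x hx
    obtain ⟨t, ht, rfl⟩ := Finset.mem_image.mp hx
    obtain ⟨b, hb⟩ := hc t ht
    have h1 := hP t ht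
    have h2 := hQ t ht
    rw [← hb] at h1 h2
    have h3 : finsetConfig P (0 - t) = finsetConfig Q (0 - t) :=
      Eq.trans (show _ = b from h1) (Eq.symm h2)
    rw [zero_sub] at h3
    exact decide_eq_decide.mp h3
  refine Subtype.ext (Finset.ext fun x => ?_)
  by_cases hx : x ∈ (TopDyn.box n).image Neg.neg
  · exact hiff x hx
  · exact iff_of_false (fun h => hx ((mem_patterns.mp P.2).1 h))
      fun h => hx ((mem_patterns.mp Q.2).1 h)

/-! ### The topological entropy -/

/-- For fixed `L`, neither the number `D` of coset choices nor the enlargement `K` of the window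
depends on `n`, so both disappear after division by `n ^ 2`. -/
theorem coverEntropy_le (L : ℕ) {𝒰 : Set (Set Hull)} (h𝒰 : TopDyn.IsOpenCover 𝒰) :
    TopDyn.coverEntropy 𝒰 ≤ ((avoidingDensity L * Real.log 2 : ℝ) : EReal) := by
  obtain ⟨r, hr⟩ := exists_subcover_card_le h𝒰
  set M : ℕ := ∏ p ∈ Nat.primesBelow L, p with hM
  have hMpos : 0 < M := Finset.prod_pos fun p hp => (Nat.prime_of_mem_primesBelow hp).pos
  set D : ℕ := Fintype.card (Residues L) with hD
  have hDpos : 0 < D := Fintype.card_pos_iff.mpr ⟨residues L 0⟩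
  set C : ℝ := avoidingDensity L * Real.log 2 with hC
  have hC0 : 0 ≤ C := mul_nonneg (avoidingDensity_nonneg L) (Real.log_nonneg one_le_two)
  set K : ℝ := ((2 * r + 1 + M : ℕ) : ℝ) with hK
  have hbound : ∀ n : ℕ,
      Real.log (TopDyn.minSubcover (TopDyn.joinCover (TopDyn.box n) 𝒰)) ≤
        Real.log D + (n + K) ^ 2 * C := by
    intro n
    -- The side of the window is rounded up to a multiple of `M`, where the count of avoiding points
    -- is exact.
    set k := (n + 2 * r + 1) / M + 1 with hk
    have hk1 : n + 2 * r + 1 ≤ k * M := by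
      have := Nat.lt_div_mul_add hMpos (a := n + 2 * r + 1)
      rw [hk, add_mul, one_mul]
      exact this.le
    have hk2 : ((k * M : ℕ) : ℝ) ≤ n + K := by
      have := Nat.div_mul_le_self (n + 2 * r + 1) M
      have h : k * M ≤ n + (2 * r + 1 + M) := by
        rw [hk, add_mul, one_mul]
        omega
      rw [hK]
      exact_mod_cast h
    obtain ⟨s, hs, hs', hcard⟩ := hr n (k * M) hk1
    have hN : TopDyn.minSubcover (TopDyn.joinCover (TopDyn.box n) 𝒰) ≤
        D * 2 ^ (k ^ 2 * ∏ p ∈ Nat.primesBelow L, (p ^ 2 - 1)) := by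
      refine le_trans ?_ (hcard.trans (card_patterns_square_le L _ k))
      exact Nat.sInf_le ⟨s, hs, hs', rfl⟩
    have hlog : Real.log (TopDyn.minSubcover (TopDyn.joinCover (TopDyn.box n) 𝒰)) ≤
        Real.log ((D * 2 ^ (k ^ 2 * ∏ p ∈ Nat.primesBelow L, (p ^ 2 - 1)) : ℕ) : ℝ) := by
      rcases Nat.eq_zero_or_pos (TopDyn.minSubcover (TopDyn.joinCover (TopDyn.box n) 𝒰))
        with h0 | h0
      · rw [h0, Nat.cast_zero, Real.log_zero]
        exact Real.log_natCast_nonneg _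
      · exact Real.log_le_log (by exact_mod_cast h0) (by exact_mod_cast hN)
    refine hlog.trans ?_
    rw [Nat.cast_mul, Real.log_mul (by exact_mod_cast hDpos.ne') (by positivity), Nat.cast_pow,
      Real.log_pow, Nat.cast_mul, cast_prod_sq_sub_one, ← hM]
    have hsq : ((k * M : ℕ) : ℝ) ^ 2 * C ≤ (n + K) ^ 2 * C := by gcongr
    refine add_le_add_right (le_trans (le_of_eq ?_) hsq) _
    rw [hC]
    push_cast
    ring
  have hlim : Tendsto (fun n : ℕ => (Real.log D + (n + K) ^ 2 * C) / (n : ℝ) ^ 2) atTop (𝓝 C) := by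
    have hinv : Tendsto (fun n : ℕ => ((n : ℝ))⁻¹) atTop (𝓝 0) :=
      tendsto_inv_atTop_nhds_zero_nat
    have h := ((hinv.pow 2).const_mul (Real.log D)).add
      ((((hinv.const_mul K).const_add 1).pow 2).mul_const C)
    simp only [ne_eq, OfNat.ofNat_ne_zero, not_false_eq_true, zero_pow, mul_zero, add_zero,
      one_pow, one_mul, zero_add] at h
    refine h.congr' ?_
    filter_upwards [eventually_gt_atTop 0] with n hn
    have : (n : ℝ) ≠ 0 := by exact_mod_cast hn.ne'
    field_simp
  rw [← ((continuous_coe_real_ereal.tendsto C).comp hlim).limsup_eq]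
  refine limsup_le_limsup (Eventually.of_forall fun n => ?_)
  exact EReal.coe_le_coe_iff.mpr (div_le_div_of_nonneg_right (hbound n) (by positivity))

theorem le_coverEntropy_originCover :
    ((6 / Real.pi ^ 2 * Real.log 2 : ℝ) : EReal) ≤ TopDyn.coverEntropy originCover := by
  -- Here `L = n + 1` grows with the box, which keeps its `n ^ 2` points below `L ^ 2`, as
  -- `two_pow_le_card_patterns` requires.
  have hlim : Tendsto (fun n : ℕ => avoidingDensity (n + 1) * Real.log 2) atTop
      (𝓝 (6 / Real.pi ^ 2 * Real.log 2)) :=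
    ((tendsto_add_atTop_iff_nat 1).mpr tendsto_avoidingDensity).mul_const _
  rw [← ((continuous_coe_real_ereal.tendsto _).comp hlim).limsup_eq]
  refine limsup_le_limsup ?_
  filter_upwards [eventually_gt_atTop 0] with n hn
  refine EReal.coe_le_coe_iff.mpr ?_
  have hn' : (0 : ℝ) < (n : ℝ) ^ 2 := by positivity
  rw [le_div_iff₀ hn']
  set F := (TopDyn.box n).image Neg.neg with hF
  have hcard : F.card = n ^ 2 := by
    rw [hF, Finset.card_image_of_injective _ neg_injective, TopDyn.box, Finset.card_product,
      Int.card_Ico, sub_zero, Int.toNat_natCast, sq]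
  obtain ⟨g, hg⟩ := exists_card_avoiding_ge (n + 1) F
  have hlt : F.card < (n + 1) ^ 2 := by
    rw [hcard]
    exact Nat.pow_lt_pow_left n.lt_succ_self two_ne_zero
  have h1 := (two_pow_le_card_patterns hlt g).trans (card_patterns_le_minSubcover n)
  have h2 : Real.log ((2 ^ (avoiding F g).card : ℕ) : ℝ) ≤
      Real.log (TopDyn.minSubcover (TopDyn.joinCover (TopDyn.box n) originCover)) :=
    Real.log_le_log (by positivity) (by exact_mod_cast h1)
  refine le_trans ?_ h2
  rw [Nat.cast_pow, Real.log_pow]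
  have h3 := mul_le_mul_of_nonneg_right hg (Real.log_nonneg one_le_two)
  rw [hcard] at h3
  refine le_trans (le_of_eq ?_) h3
  push_cast
  ring

theorem topologicalEntropy_hull :
    TopDyn.topologicalEntropy Hull = ((6 / Real.pi ^ 2 * Real.log 2 : ℝ) : EReal) := by
  refine le_antisymm (iSup_le fun 𝒰 => ?_) ?_
  -- The bound for a fixed cover holds for every `L`; only now does `L` tend to infinity.
  · exact ge_of_tendsto' ((continuous_coe_real_ereal.tendsto _).comp
      (tendsto_avoidingDensity.mul_const (Real.log 2))) fun L => coverEntropy_le L 𝒰.2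
  · exact le_coverEntropy_originCover.trans
      (le_iSup (fun 𝒰 : {𝒰 : Set (Set Hull) // TopDyn.IsOpenCover 𝒰} => TopDyn.coverEntropy 𝒰.1)
        ⟨originCover, isOpenCover_originCover⟩)

theorem topologicalEntropy_hull_pos : 0 < TopDyn.topologicalEntropy Hull := by
  rw [topologicalEntropy_hull]
  have := Real.log_pos one_lt_two
  exact EReal.coe_pos.mpr (by positivity)

end VisiblePoints

end

theorem theorem4 :
    -- (a) topological ergodicity and entropy
    (TopDyn.IsTopologicallyErgodic (ℤ × ℤ) VisiblePoints.Hull ∧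
      TopDyn.topologicalEntropy VisiblePoints.Hull =
        ((6 / Real.pi ^ 2 * Real.log 2 : ℝ) : EReal) ∧
      0 < TopDyn.topologicalEntropy VisiblePoints.Hull) ∧
    -- (b) proximality and the unique minimal subset
    (TopDyn.IsProximal (ℤ × ℤ) VisiblePoints.Hull ∧
      ∃ h : VisiblePoints.emptyConfig ∈ VisiblePoints.hull,
        ∀ M : Set VisiblePoints.Hull,
          TopDyn.IsMinimalSubset (ℤ × ℤ) M ↔ M = {⟨VisiblePoints.emptyConfig, h⟩}) ∧
    -- (c) no nontrivial Kronecker factor, trivial topological point spectrum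
    ((∀ (Y : Type u) [TopologicalSpace Y] [AddAction (ℤ × ℤ) Y],
        TopDyn.IsKronecker (ℤ × ℤ) Y →
        ∀ π : VisiblePoints.Hull → Y, TopDyn.IsFactorMap (ℤ × ℤ) π → Subsingleton Y) ∧
      TopDyn.topologicalPointSpectrum (ℤ × ℤ) VisiblePoints.Hull = {1} ∧
      ∀ (χ : AddChar (ℤ × ℤ) Circle) (f : VisiblePoints.Hull → ℂ),
        TopDyn.IsEigenfunction χ f → ∃ c : ℂ, ∀ X, f X = c) ∧
    -- (d) nontrivial joining with the rotation, no topological weak mixing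
    (TopDyn.IsKronecker (ℤ × ℤ) VisiblePoints.KGroup ∧
      (∃ W : Set (VisiblePoints.Hull × VisiblePoints.KGroup),
        TopDyn.IsJoining (ℤ × ℤ) W ∧ W ≠ Set.univ) ∧
      ¬ TopDyn.IsTopologicallyWeaklyMixing (ℤ × ℤ) VisiblePoints.Hull) := by
  refine ⟨⟨VisiblePoints.isTopologicallyErgodic_hull, VisiblePoints.topologicalEntropy_hull,
    VisiblePoints.topologicalEntropy_hull_pos⟩, ⟨VisiblePoints.isProximal_hull,
    VisiblePoints.emptyConfig_mem_hull, fun _ => VisiblePoints.isMinimalSubset_iff⟩,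
    ⟨fun _ _ _ hY π hπ => VisiblePoints.subsingleton_of_isFactorMap hY π hπ,
      VisiblePoints.topologicalPointSpectrum_hull,
      fun _ _ hf => ⟨_, VisiblePoints.eigenfunction_eq hf⟩⟩,
    VisiblePoints.isKronecker_kgroup,
    ⟨_, VisiblePoints.isJoining_missedCosets, VisiblePoints.missedCosets_ne_univ⟩,
    VisiblePoints.not_isTopologicallyWeaklyMixing_hull⟩
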